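/- Theorem. Let $X=\{x_0<x_1<\cdots<x_m\}$ be a finite totally ordered alphabet, $X^+$ the set of nonempty words over $X$ ordered lexicographically, and $|\eta|$ the length of a word $\eta$. Let $\mathbb{R}_p\langle X\rangle$ be the real vector space with basis $X^+$ (the noncommutative polynomials whose coefficient at the empty word $\emptyset$ is zero), with the shuffle product, i.e. the bilinear product determined on words by $$(x_i\eta)\sqcup\!\sqcup(x_j\xi)=x_i\bigl(\eta\sqcup\!\sqcup(x_j\xi)\bigr)+x_j\bigl((x_i\eta)\sqcup\!\sqcup\xi\bigr),\qquad \eta\sqcup\!\sqcup\emptyset=\emptyset\sqcup\!\sqcup\eta=\eta .$$ A word $\eta\in X^+$ is a Lyndon word if $\eta<\nu\xi$ for every factorization $\eta=\xi\nu$ with $\xi,\nu\in X^+$. Let $L$ be the set of Lyndon words; for $l\in L$ write $(l)$ for $l$ as a word in $X^+$. Let $\mathbb{R}[L]$ be the space of real commutative polynomials without constant term in the variables $l\in L$; it has as basis the set $L^+$ of Lyndon monomials $l_{i_1}\cdots l_{i_n}$, $n\ge 1$. Grade both spaces by word length: for $k\geq 1$ let $\mathbb{R}\langle X^k\rangle$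 be the span of the words of length $k$, and $\mathbb{R}[L^k]$ the span of the Lyndon monomials with $|(l_{i_1})|+\cdots+|(l_{i_n})|=k$. Then $$\mathbb{R}_p\langle X\rangle=\bigoplus_{k>0}\mathbb{R}\langle X^k\rangle,\qquad \mathbb{R}[L]=\bigoplus_{k>0}\mathbb{R}[L^k].$$ There is a unique $\mathbb{R}$-linear map $\mathscr{L}:\mathbb{R}_p\langle X\rangle\to\mathbb{R}[L]$ with $\mathscr{L}(p\sqcup\!\sqcup q)=\mathscr{L}(p)\mathscr{L}(q)$ for all $p,q\in\mathbb{R}_p\langle X\rangle$ and $\mathscr{L}((l))=l$ for all $l\in L$, and a unique $\mathbb{R}$-linear map $\Psi:\mathbb{R}[L]\to\mathbb{R}_p\langle X\rangle$ with $$\Psi(l_{i_1}\cdots l_{i_n})=(l_{i_1})\sqcup\!\sqcup\cdots\sqcup\!\sqcup(l_{i_n})$$ for all $n\ge1$ and all $l_{i_1},\dots,l_{i_n}\in L$. The map $\mathscr{L}$ is an isomorphism of graded real vector spaces with inverse $\Psi$: it is bijective, $\Psi\circ\mathscr{L}=\mathrm{id}$, $\mathscr{L}\circ\Psi=\mathrm{id}$,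 and $\mathscr{L}(\mathbb{R}\langle X^k\rangle)=\mathbb{R}[L^k]$ for every $k>0$. -/

import Mathlib

namespace LyndonShuffle

noncomputable section

/-- Noncommutative real polynomials over the alphabet `X`: finitely supported functions on the
set `X^*` of words. -/
abbrev NCPoly (X : Type*) := List X →₀ ℝ

/-- The shuffle product of two words. -/
def shuffleWord {X : Type*} : List X → List X → NCPoly X
  | [], v => Finsupp.single v 1
  | a :: u, [] => Finsupp.single (a :: u) 1
  | a :: u, b :: v =>
      Finsupp.mapDomain (List.cons a) (shuffleWord u (b :: v)) +
        Finsupp.mapDomain (List.cons b) (shuffleWord (a :: u) v)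
  termination_by u v => u.length + v.length

/-- The shuffle product of polynomials: the bilinear extension of the shuffle product of words. -/
def shuffle {X : Type*} : NCPoly X →ₗ[ℝ] NCPoly X →ₗ[ℝ] NCPoly X :=
  Finsupp.linearCombination ℝ fun u => Finsupp.linearCombination ℝ fun v => shuffleWord u v

/-- The iterated shuffle product of a list of words (the empty word for the empty list). -/
def shuffleList {X : Type*} : List (List X) → NCPoly X
  | [] => Finsupp.single [] 1
  | w :: ws => shuffle (Finsupp.single w 1) (shuffleList ws)

/-- The space of proper polynomials: the coefficient of the empty word vanishes. -/
def properPoly (X : Type*) : Submodule ℝ (NCPoly X) :=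
  LinearMap.ker (Finsupp.lapply ([] : List X) : NCPoly X →ₗ[ℝ] ℝ)

/-- A nonempty word as a proper polynomial. -/
def ofWord {X : Type*} (w : List X) (hw : w ≠ []) : properPoly X :=
  ⟨Finsupp.single w 1, by simp [properPoly, hw]⟩

theorem shuffleWord_apply_nil {X : Type*} (u v : List X) (hu : u ≠ []) :
    shuffleWord u v [] = 0 := by
  cases u with
  | nil => exact absurd rfl hu
  | cons a u =>
    cases v with
    | nil => simp [shuffleWord]
    | cons b v =>
      rw [shuffleWord, Finsupp.add_apply, Finsupp.mapDomain_of_notMem_range _ _ (by simp),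
        Finsupp.mapDomain_of_notMem_range _ _ (by simp), add_zero]

theorem shuffle_apply_nil {X : Type*} {p : NCPoly X} (hp : p ∈ properPoly X) (q : NCPoly X) :
    shuffle p q ∈ properPoly X := by
  have hp' : p [] = 0 := hp
  simp only [properPoly, LinearMap.mem_ker, Finsupp.lapply_apply, shuffle,
    Finsupp.linearCombination_apply, Finsupp.sum, LinearMap.sum_apply, LinearMap.smul_apply,
    Finsupp.finsetSum_apply, Finsupp.smul_apply, smul_eq_mul]
  refine Finset.sum_eq_zero fun u hu => ?_
  have hne : u ≠ [] := by
    rintro rfl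
    exact (Finsupp.mem_support_iff.mp hu) hp'
  simp [shuffleWord_apply_nil u _ hne]

/-- The shuffle product on proper polynomials. -/
def properShuffle {X : Type*} (p q : properPoly X) : properPoly X :=
  ⟨shuffle (p : NCPoly X) (q : NCPoly X), shuffle_apply_nil p.2 _⟩

/-- A Lyndon word: a nonempty word which is lexicographically strictly smaller than each of its
nontrivial rotations. -/
def IsLyndon {X : Type*} [LinearOrder X] (w : List X) : Prop :=
  w ≠ [] ∧ ∀ u v : List X, u ≠ [] → v ≠ [] → w = u ++ v → w < v ++ u

/-- The set `L` of Lyndon words over `X`. -/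
abbrev LyndonWord (X : Type*) [LinearOrder X] := {w : List X // IsLyndon w}

/-- The commutative real polynomials without constant term in variables indexed by the Lyndon
words; the nonempty Lyndon monomials form a basis. -/
def lyndonPoly (X : Type*) [LinearOrder X] : Submodule ℝ (MvPolynomial (LyndonWord X) ℝ) :=
  LinearMap.ker (MvPolynomial.lcoeff ℝ (0 : LyndonWord X →₀ ℕ))

/-- The Lyndon monomial `l₁ ⋯ lₙ`, `n ≥ 1`. -/
def lyndonMonomial {X : Type*} [LinearOrder X] (ls : List (LyndonWord X)) (h : ls ≠ []) :
    lyndonPoly X :=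
  ⟨(ls.map MvPolynomial.X).prod, by
    obtain ⟨l, ls, rfl⟩ := List.exists_cons_of_ne_nil h
    change MvPolynomial.coeff 0 _ = 0
    rw [← MvPolynomial.constantCoeff_eq]
    simp⟩

/-- The degree `k` component of the proper polynomials, spanned by the words of length `k`. -/
def wordGrade (X : Type*) (k : ℕ+) : Submodule ℝ (properPoly X) :=
  (Finsupp.supported ℝ ℝ {w : List X | w.length = (k : ℕ)}).submoduleOf (properPoly X)

/-- The degree `k` component of `lyndonPoly X`, where the variable of a Lyndon word has its
length as degree. -/
def lyndonGrade (X : Type*) [LinearOrder X] (k : ℕ+) : Submodule ℝ (lyndonPoly X) :=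
  (MvPolynomial.weightedHomogeneousSubmodule ℝ
    (fun l : LyndonWord X => l.1.length) (k : ℕ)).submoduleOf (lyndonPoly X)

/-- The properties that determine the linear map `ℒ`: it turns shuffle products into products
and sends each Lyndon word to the corresponding variable. -/
structure IsLyndonMap {X : Type*} [LinearOrder X] (ℒ : properPoly X →ₗ[ℝ] lyndonPoly X) :
    Prop where
  map_shuffle : ∀ p q : properPoly X,
    (ℒ (properShuffle p q) : MvPolynomial (LyndonWord X) ℝ) =
      (ℒ p : MvPolynomial (LyndonWord X) ℝ) * (ℒ q : MvPolynomial (LyndonWord X) ℝ)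
  map_lyndon : ∀ l : LyndonWord X,
    (ℒ (ofWord l.1 l.2.1) : MvPolynomial (LyndonWord X) ℝ) = MvPolynomial.X l

/-- The property that determines the linear map `Ψ`: a Lyndon monomial `l₁ ⋯ lₙ`, `n ≥ 1`, is
sent to the shuffle product of the words `l₁, …, lₙ`. -/
def IsShuffleMap {X : Type*} [LinearOrder X] (Ψ : lyndonPoly X →ₗ[ℝ] properPoly X) : Prop :=
  ∀ (ls : List (LyndonWord X)) (h : ls ≠ []),
    (Ψ (lyndonMonomial ls h) : NCPoly X) = shuffleList (ls.map Subtype.val)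

end

end LyndonShuffle

/-! This is Radford's theorem, proved by triangularity. Words form a commutative algebra under the
shuffle product, so sending each variable to its Lyndon word extends to an algebra map `lyndonMap`.
For Lyndon words l₁ ≤ ⋯ ≤ lₙ the largest word in their shuffle is lₙ⋯l₁, and its coefficient is
positive (`le_revConcat_of_shuffleList_ne_zero`, `shuffleList_revConcat_pos`). By the
Chen–Fox–Lyndon factorization (`revConcat_injOn`, `exists_revConcat_eq`) each word has this form for
exactly one monomial. Hence `leadingWord` is a length-preserving bijection from monomials to words,
and in each degree `lyndonMap` is triangular with nonzero diagonal. A finite alphabet has finitely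
many words of each length, so `lyndonMap` is bijective degree by degree.

The constant term corresponds to the coefficient of the empty word, so the bijection restricts to
the proper parts. The restriction is Ψ and its inverse is ℒ; both are unique because Lyndon
monomials span.

Factors are listed in increasing order, so the head of a list is the last factor of its word. -/

namespace LyndonShuffle

/-! ### Lexicographic order and concatenation. -/

section Order

variable {X : Type*} [LinearOrder X]

theorem list_cons_le_cons_iff {a b : X} {u v : List X} :
    a :: u ≤ b :: v ↔ a < b ∨ a = b ∧ u ≤ v := by
  simp only [le_iff_lt_or_eq, List.cons_lt_cons_iff, List.cons.injEq]
  tauto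

theorem list_nil_le (u : List X) : [] ≤ u :=
  le_of_not_gt fun h => List.not_lt_nil u h

theorem list_append_lt_append_left_iff (p : List X) {u v : List X} :
    p ++ u < p ++ v ↔ u < v := by
  induction p with
  | nil => rfl
  | cons a p ih => simpa [List.cons_lt_cons_iff] using ih

theorem list_le_append (u v : List X) : u ≤ u ++ v := by
  induction u with
  | nil => exact list_nil_le v
  | cons a u ih => exact List.cons_le_cons a ih

/-- If `u < v`, then either `u` is a proper prefix of `v`, or the comparison is decided at a
letter and persists under arbitrary extensions on the right. -/
theorem list_lt_cases {u v : List X} (h : u < v) :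
    (∃ t, t ≠ [] ∧ v = u ++ t) ∨ ∀ x y, u ++ x < v ++ y := by
  induction u generalizing v with
  | nil => exact Or.inl ⟨v, by rintro rfl; exact List.not_lt_nil _ h, rfl⟩
  | cons a u ih =>
    cases v with
    | nil => exact absurd h (List.not_lt_nil _)
    | cons b v =>
      rcases List.cons_lt_cons_iff.1 h with hab | ⟨rfl, huv⟩
      · exact Or.inr fun x y => List.cons_lt_cons_iff.2 (Or.inl hab)
      · rcases ih huv with ⟨t, ht, rfl⟩ | hxy
        · exact Or.inl ⟨t, ht, rfl⟩
        · exact Or.inr fun x y => List.cons_lt_cons_iff.2 (Or.inr ⟨rfl, hxy x y⟩)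

theorem list_append_lt_append_of_lt {u v : List X} (h : u < v) (hl : v.length ≤ u.length)
    (x y : List X) : u ++ x < v ++ y := by
  rcases list_lt_cases h with ⟨t, ht, rfl⟩ | hxy
  · simp [ht] at hl
  · exact hxy x y

end Order

/-! ### Lyndon words and the Chen–Fox–Lyndon factorization. -/

section Lyndon

variable {X : Type*} [LinearOrder X]

/-- Suppose v < w. If a letter decides this, the rotation vu is also below w. Otherwise w = vt, and
w < vu gives t < u with |t| = |u|, so the rotation tv is below uv = w. Both contradict the rotation
condition. -/
theorem IsLyndon.lt_suffix {w u v : List X} (hw : IsLyndon w) (hu : u ≠ []) (hv : v ≠ [])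
    (h : w = u ++ v) : w < v := by
  by_contra hlt
  have hne : v ≠ w := by
    rintro rfl
    exact hu (List.self_eq_append_left.1 h)
  have hvw : v < w := lt_of_le_of_ne (not_lt.1 hlt) hne
  rcases list_lt_cases hvw with ⟨t, ht, hvt⟩ | hxy
  · have h1 : v ++ t < v ++ u := hvt ▸ hw.2 u v hu hv h
    have htu : t < u := (list_append_lt_append_left_iff v).1 h1
    have hlen : u.length ≤ t.length := by
      have h2 := congrArg List.length h
      have h3 := congrArg List.length hvt
      simp at h2 h3
      omega
    have h4 : t ++ v < w := h ▸ list_append_lt_append_of_lt htu hlen v v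
    exact absurd (hw.2 v t hv ht hvt) (not_lt.2 h4.le)
  · have h1 := hxy u []
    rw [List.append_nil] at h1
    exact absurd (hw.2 u v hu hv h) (not_lt.2 h1.le)

theorem IsLyndon.le_suffix {w v : List X} (hw : IsLyndon w) (hv : v ≠ []) (h : v <:+ w) :
    w ≤ v := by
  obtain ⟨u, rfl⟩ := h
  rcases eq_or_ne u [] with rfl | hu
  · simp
  · exact (hw.lt_suffix hu hv rfl).le

theorem isLyndon_of_le_suffix {w : List X} (hw : w ≠ []) (h : ∀ v, v ≠ [] → v <:+ w → w ≤ v) :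
    IsLyndon w := by
  refine ⟨hw, fun u v hu hv huv => ?_⟩
  have hne : w ≠ v := by
    rintro rfl
    exact hu (List.self_eq_append_left.1 huv)
  exact (lt_of_le_of_ne (h v hv ⟨u, huv.symm⟩) hne).trans_le (list_le_append v u)

/-- The concatenation of a list of words in reverse order. -/
def revConcat {Y : Type*} (ls : List (List Y)) : List Y := ls.reverse.flatten

@[simp] theorem revConcat_nil {Y : Type*} : revConcat ([] : List (List Y)) = [] := rfl

@[simp] theorem revConcat_cons {Y : Type*} (l : List Y) (ls : List (List Y)) :
    revConcat (l :: ls) = revConcat ls ++ l := by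
  simp [revConcat]

theorem suffix_append_cases {Y : Type*} {s u v : List Y} (h : s <:+ u ++ v) :
    s <:+ v ∨ ∃ s', s' ≠ [] ∧ s' <:+ u ∧ s = s' ++ v := by
  obtain ⟨t, ht⟩ := h
  rcases List.append_eq_append_iff.1 ht with ⟨as, h1, h2⟩ | ⟨bs, h1, h2⟩
  · rcases eq_or_ne as [] with rfl | has
    · exact Or.inl (by simp [h2])
    · exact Or.inr ⟨as, has, ⟨t, h1.symm⟩, h2⟩
  · exact Or.inl ⟨bs, h2.symm⟩

/-- Every nonempty suffix of a product of Lyndon words is bounded below by any lower bound of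
the factors. -/
theorem le_suffix_revConcat {l : List X} {ls : List (List X)} (hls : ∀ w ∈ ls, IsLyndon w)
    (hl : ∀ w ∈ ls, l ≤ w) {s : List X} (hs : s ≠ []) (h : s <:+ revConcat ls) : l ≤ s := by
  induction ls generalizing s with
  | nil => exact absurd (List.suffix_nil.1 h) hs
  | cons w ls ih =>
    rw [revConcat_cons] at h
    rcases suffix_append_cases h with h' | ⟨s', hs', h', rfl⟩
    · exact (hl w (by simp)).trans ((hls w (by simp)).le_suffix hs h')
    · exact (ih (fun x hx => hls x (by simp [hx])) (fun x hx => hl x (by simp [hx])) hs' h').trans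
        (list_le_append _ _)

theorem le_suffix_revConcat_cons {l : List X} {ls : List (List X)}
    (hls : ∀ w ∈ l :: ls, IsLyndon w) (h : (l :: ls).Pairwise (· ≤ ·)) {s : List X}
    (hs : s ≠ []) (hsuf : s <:+ revConcat (l :: ls)) : l ≤ s :=
  le_suffix_revConcat hls (by simpa using (List.pairwise_cons.1 h).1) hs hsuf

/-- Uniqueness of the factorization into monotone Lyndon words. -/
theorem revConcat_injOn {ls ms : List (List X)} (hls : ∀ w ∈ ls, IsLyndon w)
    (hms : ∀ w ∈ ms, IsLyndon w) (hl : ls.Pairwise (· ≤ ·)) (hm : ms.Pairwise (· ≤ ·))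
    (h : revConcat ls = revConcat ms) : ls = ms := by
  induction ls generalizing ms with
  | nil =>
    cases ms with
    | nil => rfl
    | cons m ms =>
      rw [revConcat_cons, revConcat_nil, eq_comm, List.append_eq_nil_iff] at h
      exact absurd h.2 (hms m (by simp)).1
  | cons l ls ih =>
    cases ms with
    | nil =>
      rw [revConcat_cons, revConcat_nil, List.append_eq_nil_iff] at h
      exact absurd h.2 (hls l (by simp)).1
    | cons m ms =>
      -- The last factor is the least nonempty suffix of the word, so both factorizations end alike.
      have h1 : l ≤ m := le_suffix_revConcat_cons hls hl (hms m (by simp)).1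
        ⟨revConcat ms, by rw [h, revConcat_cons]⟩
      have h2 : m ≤ l := le_suffix_revConcat_cons hms hm (hls l (by simp)).1
        ⟨revConcat ls, by rw [← h, revConcat_cons]⟩
      obtain rfl := le_antisymm h1 h2
      rw [revConcat_cons, revConcat_cons, List.append_left_inj] at h
      rw [ih (fun x hx => hls x (by simp [hx])) (fun x hx => hms x (by simp [hx]))
        (List.pairwise_cons.1 hl).2 (List.pairwise_cons.1 hm).2 h]

theorem exists_min_suffix {w : List X} (hw : w ≠ []) :
    ∃ l, l ≠ [] ∧ l <:+ w ∧ ∀ s, s ≠ [] → s <:+ w → l ≤ s := by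
  obtain ⟨l, hl, hmin⟩ := (w.tails.toFinset.filter (· ≠ [])).exists_min_image id
    ⟨w, by simp [hw]⟩
  simp only [Finset.mem_filter, List.mem_toFinset, List.mem_tails] at hl hmin
  exact ⟨l, hl.2, hl.1, fun s hs h => hmin s ⟨h, hs⟩⟩

/-- Existence of the factorization into monotone Lyndon words. -/
theorem exists_revConcat_eq (w : List X) :
    ∃ ls : List (List X), (∀ l ∈ ls, IsLyndon l) ∧ ls.Pairwise (· ≤ ·) ∧ revConcat ls = w := by
  induction hn : w.length using Nat.strong_induction_on generalizing w with
  | _ n ih =>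
    rcases eq_or_ne w [] with rfl | hw
    · exact ⟨[], by simp⟩
    -- The least nonempty suffix is Lyndon, since its own suffixes are suffixes of the whole word.
    obtain ⟨l, hl, ⟨w', rfl⟩, hmin⟩ := exists_min_suffix hw
    have hlen := List.length_pos_iff.2 hl
    have hlyn : IsLyndon l :=
      isLyndon_of_le_suffix hl fun v hv h => hmin v hv (h.trans (List.suffix_append w' l))
    obtain ⟨ls, hls, hsort, rfl⟩ := ih w'.length (by simp at hn; omega) w' rfl
    refine ⟨l :: ls, by simpa using ⟨hlyn, hls⟩, ?_, by simp⟩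
    refine List.pairwise_cons.2 ⟨?_, hsort⟩
    cases ls with
    | nil => simp
    | cons m ms =>
      -- If m < l, the suffix ml would be smaller than l: either l = mt with l < t, so ml < mt = l,
      -- or a letter already decides m < l.
      have hlm : l ≤ m := by
        by_contra hml
        have hml := not_le.1 hml
        have hle : l ≤ m ++ l :=
          hmin (m ++ l) (by simp [hl]) ⟨revConcat ms, by simp⟩
        rcases list_lt_cases hml with ⟨t, ht, rfl⟩ | hxy
        · have := (list_append_lt_append_left_iff m).2
            (hlyn.lt_suffix (hls m (by simp)).1 ht rfl)
          exact absurd hle (not_le.2 this)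
        · have := hxy l []
          rw [List.append_nil] at this
          exact absurd hle (not_le.2 this)
      simpa [hlm] using fun x hx => hlm.trans ((List.pairwise_cons.1 hsort).1 x hx)

end Lyndon

/-! ### Interleavings and their lexicographic maximum. -/

section IsShuffle

/-- `IsShuffle u v w` holds if the word `w` is an interleaving of `u` and `v`. -/
inductive IsShuffle {Y : Type*} : List Y → List Y → List Y → Prop
  | nil : IsShuffle [] [] []
  | left {u v w : List Y} (a : Y) : IsShuffle u v w → IsShuffle (a :: u) v (a :: w)
  | right {u v w : List Y} (a : Y) : IsShuffle u v w → IsShuffle u (a :: v) (a :: w)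

namespace IsShuffle

variable {Y : Type*}

theorem symm {u v w : List Y} (h : IsShuffle u v w) : IsShuffle v u w := by
  induction h with
  | nil => exact .nil
  | left a _ ih => exact .right a ih
  | right a _ ih => exact .left a ih

theorem length_eq {u v w : List Y} (h : IsShuffle u v w) : w.length = u.length + v.length := by
  induction h with
  | nil => rfl
  | left a _ ih => simp [ih]; omega
  | right a _ ih => simp [ih]; omega

theorem nil_left (v : List Y) : IsShuffle [] v v := by
  induction v with
  | nil => exact .nil
  | cons a v ih => exact .right a ih

theorem append (u v : List Y) : IsShuffle u v (u ++ v) := by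
  induction u with
  | nil => exact nil_left v
  | cons a u ih => exact .left a ih

theorem eq_of_nil_left {v w : List Y} (h : IsShuffle [] v w) : w = v := by
  induction v generalizing w with
  | nil => cases h; rfl
  | cons a v ih => cases h with
    | right _ h => rw [ih h]

theorem eq_of_nil_right {u w : List Y} (h : IsShuffle u [] w) : w = u :=
  h.symm.eq_of_nil_left

variable {X : Type*} [LinearOrder X]

/-- Copy the given interleaving until the letter where t and t' differ is used; taking the larger
letter there settles the comparison, whatever follows. -/
theorem exists_le_of_le {u t t' w : List X} (h : IsShuffle u t w) (hle : t ≤ t')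
    (hlen : t.length = t'.length) : ∃ w', IsShuffle u t' w' ∧ w ≤ w' := by
  induction h generalizing t' with
  | nil =>
    obtain rfl : t' = [] := List.length_eq_zero_iff.1 hlen.symm
    exact ⟨[], .nil, le_rfl⟩
  | left a _ ih =>
    obtain ⟨w', h, hw⟩ := ih hle hlen
    exact ⟨a :: w', .left a h, List.cons_le_cons a hw⟩
  | @right u v w a _ ih =>
    cases t' with
    | nil => simp at hlen
    | cons b t' =>
      rcases list_cons_le_cons_iff.1 hle with hab | ⟨rfl, htt⟩
      · exact ⟨b :: (t' ++ u), .right b (append t' u).symm,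
          list_cons_le_cons_iff.2 (Or.inl hab)⟩
      · obtain ⟨w', h, hw⟩ := ih htt (by simpa using hlen)
        exact ⟨a :: w', .right a h, List.cons_le_cons a hw⟩

/-- Exchange: if `y ≤ x`, a common prefix `c` is better consumed from the word ending in `x`. -/
theorem exchange {c x y t : List X} (hxy : y ≤ x) (h : IsShuffle (c ++ x) y t) :
    ∃ t', IsShuffle x (c ++ y) t' ∧ t ≤ t' := by
  induction t generalizing c x y with
  | nil =>
    have hlen := h.length_eq.symm
    simp only [List.length_nil, Nat.add_eq_zero_iff, List.length_eq_zero_iff,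
      List.append_eq_nil_iff] at hlen
    obtain ⟨⟨rfl, rfl⟩, rfl⟩ := hlen
    exact ⟨[], .nil, le_rfl⟩
  | cons e t ih =>
    cases c with
    | nil => exact ⟨e :: t, h, le_rfl⟩
    | cons d c =>
      cases h with
      | left _ h =>
        obtain ⟨t', ht', hle⟩ := ih hxy h
        exact ⟨e :: t', .right e ht', List.cons_le_cons e hle⟩
      | @right _ y _ _ h =>
        cases x with
        | nil => exact absurd hxy (not_le.2 (List.nil_lt_cons _ _))
        | cons b x =>
          -- The letter used comes from y. If x starts with a larger letter, use that one first. If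
          -- the letters agree, take it from x instead and append it to the common prefix c.
          rcases list_cons_le_cons_iff.1 hxy with hab | ⟨rfl, hyx⟩
          · exact ⟨b :: (x ++ (d :: c ++ e :: y)), .left b (append x _),
              list_cons_le_cons_iff.2 (Or.inl hab)⟩
          · have h' : IsShuffle ((d :: c ++ [e]) ++ x) y t := by simpa using h
            obtain ⟨t', ht', hle⟩ := ih hyx h'
            exact ⟨e :: t', .left e (by simpa using ht'), List.cons_le_cons e hle⟩

/-- If every nonempty suffix of `r` is at least `l`, then `r ++ l` is the largest shuffle of
`r` and `l`. -/
theorem le_append {r l w : List X} (hr : ∀ s, s ≠ [] → s <:+ r → l ≤ s)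
    (h : IsShuffle r l w) : w ≤ r ++ l := by
  induction r generalizing w with
  | nil => rw [h.eq_of_nil_left]; rfl
  | cons a r ih =>
    have ih' {w} := @ih w fun s hs hsr => hr s hs (hsr.trans (List.suffix_cons a r))
    cases h with
    | left _ h => exact List.cons_le_cons a (ih' h)
    | @right _ l w b h =>
      rcases list_cons_le_cons_iff.1 (hr (a :: r) (by simp) List.suffix_rfl) with hab | ⟨rfl, hlr⟩
      · exact list_cons_le_cons_iff.2 (Or.inl hab)
      -- Both words start with b, so it may be charged to r instead of l without lowering the best
      -- continuation.
      · obtain ⟨t', ht', hle⟩ := exchange (c := [b]) hlr h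
        exact List.cons_le_cons b (hle.trans (ih' ht'))

end IsShuffle

end IsShuffle

end LyndonShuffle

namespace LyndonShuffle

noncomputable section

/-! ### The commutative shuffle algebra. -/

section ShuffleAlgebra

variable {X : Type*}

/-- Left concatenation with a letter. -/
def consMap (a : X) : NCPoly X →ₗ[ℝ] NCPoly X := Finsupp.lmapDomain ℝ ℝ (List.cons a)

theorem consMap_single (a : X) (u : List X) (r : ℝ) :
    consMap a (Finsupp.single u r) = Finsupp.single (a :: u) r := by
  simp [consMap]

theorem shuffle_single_single (u v : List X) (r s : ℝ) :
    shuffle (Finsupp.single u r) (Finsupp.single v s) = (r * s) • shuffleWord u v := by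
  simp [shuffle, smul_smul]

@[simp] theorem shuffleWord_nil_left (v : List X) :
    shuffleWord [] v = Finsupp.single v 1 := by
  rw [shuffleWord]

@[simp] theorem shuffleWord_nil_right (u : List X) :
    shuffleWord u [] = Finsupp.single u 1 := by
  cases u <;> rw [shuffleWord]

theorem nil_shuffle (p : NCPoly X) : shuffle (Finsupp.single [] 1) p = p := by
  induction p using Finsupp.induction_linear with
  | zero => simp
  | add p q hp hq => rw [map_add, hp, hq]
  | single v r => simp [shuffle_single_single]

/-- The recursion is needed for polynomials because in associativity one factor is itself a shuffle.
-/
theorem shuffle_consMap (a b : X) (p q : NCPoly X) :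
    shuffle (consMap a p) (consMap b q) =
      consMap a (shuffle p (consMap b q)) + consMap b (shuffle (consMap a p) q) := by
  induction p using Finsupp.induction_linear with
  | zero => simp
  | add p p' hp hp' =>
    simp only [map_add, LinearMap.add_apply, hp, hp']
    abel
  | single u r =>
    induction q using Finsupp.induction_linear with
    | zero => simp
    | add q q' hq hq' =>
      simp only [map_add, hq, hq']
      abel
    | single v s =>
      simp only [consMap_single, shuffle_single_single, map_smul, ← smul_add]
      rw [shuffleWord]
      rfl

theorem shuffleWord_comm (u v : List X) : shuffleWord u v = shuffleWord v u := by
  induction u generalizing v with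
  | nil => simp
  | cons a u ihu =>
    induction v with
    | nil => simp
    | cons b v ihv =>
      rw [shuffleWord, shuffleWord, ihv, ihu, add_comm]

theorem shuffle_comm (p q : NCPoly X) : shuffle p q = shuffle q p := by
  induction p using Finsupp.induction_linear with
  | zero => simp
  | add p p' hp hp' => rw [map_add, map_add, LinearMap.add_apply, hp, hp']
  | single u r =>
    induction q using Finsupp.induction_linear with
    | zero => simp
    | add q q' hq hq' => rw [map_add, map_add, LinearMap.add_apply, hq, hq']
    | single v s =>
      rw [shuffle_single_single, shuffle_single_single, shuffleWord_comm, mul_comm]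

theorem shuffle_nil (p : NCPoly X) : shuffle p (Finsupp.single [] 1) = p := by
  rw [shuffle_comm, nil_shuffle]

/-- Sorted by first letter, both bracketings split into the same three terms, each with one letter
fewer. -/
theorem shuffle_assoc_word (u v w : List X) :
    shuffle (shuffle (Finsupp.single u 1) (Finsupp.single v 1)) (Finsupp.single w 1) =
      shuffle (Finsupp.single u 1) (shuffle (Finsupp.single v 1) (Finsupp.single w 1)) := by
  induction u generalizing v w with
  | nil => simp only [nil_shuffle]
  | cons a u ihu =>
    induction v generalizing w with
    | nil => simp only [nil_shuffle, shuffle_nil]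
    | cons b v ihv =>
      induction w with
      | nil => simp only [shuffle_nil]
      | cons c w ihw =>
        have hu := ihu (b :: v) (c :: w)
        have hv := ihv (c :: w)
        simp only [← consMap_single] at hu hv ihw ⊢
        set U : NCPoly X := Finsupp.single u 1
        set V : NCPoly X := Finsupp.single v 1
        set W : NCPoly X := Finsupp.single w 1
        have h1 := shuffle_consMap a b U V
        have h2 := shuffle_consMap b c V W
        have h3 : shuffle (shuffle (consMap a U) (consMap b V)) (consMap c W) =
            consMap a (shuffle (shuffle U (consMap b V)) (consMap c W)) +
            consMap b (shuffle (shuffle (consMap a U) V) (consMap c W)) +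
            consMap c (shuffle (shuffle (consMap a U) (consMap b V)) W) := by
          simp only [h1, map_add, LinearMap.add_apply, shuffle_consMap]
          abel
        have h4 : shuffle (consMap a U) (shuffle (consMap b V) (consMap c W)) =
            consMap a (shuffle U (shuffle (consMap b V) (consMap c W))) +
            consMap b (shuffle (consMap a U) (shuffle V (consMap c W))) +
            consMap c (shuffle (consMap a U) (shuffle (consMap b V) W)) := by
          simp only [h2, map_add, shuffle_consMap]
          abel
        rw [h3, h4, hu, hv, ihw]

theorem shuffle_assoc (p q s : NCPoly X) :
    shuffle (shuffle p q) s = shuffle p (shuffle q s) := by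
  induction p using Finsupp.induction_linear with
  | zero => simp
  | add p p' hp hp' => simp only [map_add, LinearMap.add_apply, hp, hp']
  | single u a =>
    induction q using Finsupp.induction_linear with
    | zero => simp
    | add q q' hq hq' => simp only [map_add, LinearMap.add_apply, hq, hq']
    | single v b =>
      induction s using Finsupp.induction_linear with
      | zero => simp
      | add s s' hs hs' => simp only [map_add, hs, hs']
      | single w c =>
        rw [← Finsupp.smul_single_one u, ← Finsupp.smul_single_one v,
          ← Finsupp.smul_single_one w]
        simp only [map_smul, LinearMap.smul_apply, shuffle_assoc_word]

/-- The noncommutative polynomials as a commutative algebra under the shuffle product. -/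
def ShuffleAlgebra (X : Type*) := NCPoly X

instance : AddCommGroup (ShuffleAlgebra X) := inferInstanceAs (AddCommGroup (NCPoly X))

instance : Module ℝ (ShuffleAlgebra X) := inferInstanceAs (Module ℝ (NCPoly X))

instance : CommRing (ShuffleAlgebra X) :=
  { (inferInstance : AddCommGroup (ShuffleAlgebra X)) with
    mul := fun p q => shuffle (X := X) p q
    one := (Finsupp.single [] 1 : NCPoly X)
    left_distrib := fun p q s => (shuffle (X := X) p).map_add q s
    right_distrib := fun p q s => LinearMap.map_add₂ (shuffle (X := X)) p q s
    zero_mul := fun p => LinearMap.map_zero₂ (shuffle (X := X)) p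
    mul_zero := fun p => (shuffle (X := X) p).map_zero
    mul_assoc := shuffle_assoc
    mul_comm := shuffle_comm
    one_mul := nil_shuffle
    mul_one := shuffle_nil }

instance : Algebra ℝ (ShuffleAlgebra X) :=
  Algebra.ofModule (fun r p q => LinearMap.map_smul₂ (shuffle (X := X)) r p q)
    (fun r p q => (shuffle (X := X) p).map_smul r q)

end ShuffleAlgebra

/-! ### Supports and leading words of iterated shuffles. -/

section Coefficients

variable {X : Type*}

theorem mapDomain_cons_apply_cons [DecidableEq X] (a b : X) (p : NCPoly X) (w : List X) :
    Finsupp.mapDomain (List.cons a) p (b :: w) = if a = b then p w else 0 := by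
  split_ifs with h
  · subst h
    exact Finsupp.mapDomain_apply (List.cons_injective) p w
  · exact Finsupp.mapDomain_of_notMem_range _ _ (by simp [h])

/-- Nonnegativity rules out cancellation, so the support consists of all interleavings. -/
theorem shuffleWord_nonneg (u v w : List X) : 0 ≤ shuffleWord u v w := by
  classical
  induction w generalizing u v with
  | nil =>
    rcases eq_or_ne u [] with rfl | hu
    · rw [shuffleWord_nil_left, Finsupp.single_apply]
      split_ifs <;> norm_num
    · rw [shuffleWord_apply_nil u v hu]
  | cons c w ih =>
    rcases u with _ | ⟨a, u⟩
    · rw [shuffleWord_nil_left, Finsupp.single_apply]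
      split_ifs <;> norm_num
    rcases v with _ | ⟨b, v⟩
    · rw [shuffleWord_nil_right, Finsupp.single_apply]
      split_ifs <;> norm_num
    rw [shuffleWord, Finsupp.add_apply, mapDomain_cons_apply_cons, mapDomain_cons_apply_cons]
    have h1 := ih u (b :: v)
    have h2 := ih (a :: u) v
    split_ifs <;> linarith

theorem isShuffle_of_shuffleWord_ne_zero {u v w : List X} (h : shuffleWord u v w ≠ 0) :
    IsShuffle u v w := by
  classical
  induction w generalizing u v with
  | nil =>
    rcases u with _ | ⟨a, u⟩
    · rw [shuffleWord_nil_left, Finsupp.single_apply_ne_zero] at h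
      rw [← h.1]
      exact .nil
    · exact absurd (shuffleWord_apply_nil _ v (by simp)) h
  | cons c w ih =>
    rcases u with _ | ⟨a, u⟩
    · rw [shuffleWord_nil_left, Finsupp.single_apply_ne_zero] at h
      rw [← h.1]
      exact .nil_left _
    rcases v with _ | ⟨b, v⟩
    · rw [shuffleWord_nil_right, Finsupp.single_apply_ne_zero] at h
      rw [← h.1]
      exact (IsShuffle.nil_left _).symm
    rw [shuffleWord, Finsupp.add_apply, mapDomain_cons_apply_cons,
      mapDomain_cons_apply_cons] at h
    by_cases h1 : (if a = c then shuffleWord u (b :: v) w else 0) = 0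
    · rw [h1, zero_add, ite_ne_right_iff] at h
      rw [← h.1]
      exact .right b (ih h.2)
    · rw [← ne_eq, ite_ne_right_iff] at h1
      rw [← h1.1]
      exact .left a (ih h1.2)

theorem shuffleWord_pos {u v w : List X} (h : IsShuffle u v w) : 0 < shuffleWord u v w := by
  classical
  induction h with
  | nil => simp
  | @left u v w a h ih =>
    rcases v with _ | ⟨b, v⟩
    · simp [h.eq_of_nil_right]
    · rw [shuffleWord, Finsupp.add_apply, mapDomain_cons_apply_cons, mapDomain_cons_apply_cons,
        if_pos rfl]
      have := shuffleWord_nonneg (a :: u) v w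
      split_ifs <;> linarith
  | @right u v w a h ih =>
    rcases u with _ | ⟨b, u⟩
    · simp [h.eq_of_nil_left]
    · rw [shuffleWord, Finsupp.add_apply, mapDomain_cons_apply_cons, mapDomain_cons_apply_cons,
        if_pos rfl]
      have := shuffleWord_nonneg u (a :: v) w
      split_ifs <;> linarith

theorem single_shuffle_apply (u : List X) (p : NCPoly X) (w : List X) :
    shuffle (Finsupp.single u 1) p w = ∑ v ∈ p.support, p v * shuffleWord u v w := by
  simp [shuffle, Finsupp.linearCombination_apply, Finsupp.sum, Finsupp.finsetSum_apply]

theorem shuffleList_nonneg (ls : List (List X)) (w : List X) : 0 ≤ shuffleList ls w := by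
  classical
  induction ls generalizing w with
  | nil =>
    rw [shuffleList, Finsupp.single_apply]
    split_ifs <;> norm_num
  | cons l ls ih =>
    rw [shuffleList, single_shuffle_apply]
    exact Finset.sum_nonneg fun v _ => mul_nonneg (ih v) (shuffleWord_nonneg l v w)

theorem shuffleList_cons_pos {l v w : List X} {ls : List (List X)} (hv : 0 < shuffleList ls v)
    (h : IsShuffle l v w) : 0 < shuffleList (l :: ls) w := by
  rw [shuffleList, single_shuffle_apply]
  exact Finset.sum_pos' (fun v _ => mul_nonneg (shuffleList_nonneg ls v) (shuffleWord_nonneg l v w))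
    ⟨v, Finsupp.mem_support_iff.2 hv.ne', mul_pos hv (shuffleWord_pos h)⟩

theorem exists_isShuffle_of_shuffleList_cons_ne_zero {l w : List X} {ls : List (List X)}
    (h : shuffleList (l :: ls) w ≠ 0) : ∃ v, shuffleList ls v ≠ 0 ∧ IsShuffle l v w := by
  rw [shuffleList, single_shuffle_apply] at h
  obtain ⟨v, -, hv⟩ := Finset.exists_ne_zero_of_sum_ne_zero h
  exact ⟨v, left_ne_zero_of_mul hv, isShuffle_of_shuffleWord_ne_zero (right_ne_zero_of_mul hv)⟩

theorem shuffleList_revConcat_pos (ls : List (List X)) : 0 < shuffleList ls (revConcat ls) := by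
  induction ls with
  | nil => simp [shuffleList]
  | cons l ls ih =>
    rw [revConcat_cons]
    exact shuffleList_cons_pos ih (IsShuffle.append _ l).symm

theorem length_of_shuffleList_ne_zero {ls : List (List X)} {w : List X}
    (h : shuffleList ls w ≠ 0) : w.length = (revConcat ls).length := by
  induction ls generalizing w with
  | nil =>
    rw [shuffleList, Finsupp.single_apply_ne_zero] at h
    rw [h.1, revConcat_nil]
  | cons l ls ih =>
    obtain ⟨v, hv, hw⟩ := exists_isShuffle_of_shuffleList_cons_ne_zero h
    rw [hw.length_eq, ih hv, revConcat_cons, List.length_append, add_comm]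

/-- The largest word in the shuffle product of Lyndon words is their nonincreasing
concatenation. -/
theorem le_revConcat_of_shuffleList_ne_zero [LinearOrder X] {ls : List (List X)} {w : List X}
    (hls : ∀ l ∈ ls, IsLyndon l) (hsort : ls.Pairwise (· ≤ ·)) (h : shuffleList ls w ≠ 0) :
    w ≤ revConcat ls := by
  induction ls generalizing w with
  | nil =>
    rw [shuffleList, Finsupp.single_apply_ne_zero] at h
    rw [h.1, revConcat_nil]
  | cons l ls ih =>
    obtain ⟨v, hv, hw⟩ := exists_isShuffle_of_shuffleList_cons_ne_zero h
    have hls' : ∀ x ∈ ls, IsLyndon x := fun x hx => hls x (by simp [hx])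
    have hsort' := List.pairwise_cons.1 hsort
    -- First replace v by the largest word of the remaining shuffle, which has the same length; then
    -- place l optimally.
    obtain ⟨w', hw', hle⟩ := hw.exists_le_of_le (ih hls' hsort'.2 hv)
      (length_of_shuffleList_ne_zero hv)
    rw [revConcat_cons]
    exact hle.trans (hw'.symm.le_append fun s hs h => le_suffix_revConcat hls' hsort'.1 hs h)

end Coefficients

end

end LyndonShuffle

namespace LyndonShuffle

noncomputable section

/-! ### Triangularity and bijectivity of `lyndonMap`. -/

section Radford

variable {X : Type*} [LinearOrder X]

/-- The algebra homomorphism sending the variable of a Lyndon word to that word. -/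
def lyndonHom (X : Type*) [LinearOrder X] :
    MvPolynomial (LyndonWord X) ℝ →ₐ[ℝ] ShuffleAlgebra X :=
  MvPolynomial.aeval fun l => (Finsupp.single l.1 1 : NCPoly X)

/-- `lyndonHom` as a linear map into the noncommutative polynomials. -/
def lyndonMap (X : Type*) [LinearOrder X] : MvPolynomial (LyndonWord X) ℝ →ₗ[ℝ] NCPoly X :=
  (lyndonHom X).toLinearMap

theorem lyndonMap_one : lyndonMap X 1 = Finsupp.single [] 1 :=
  map_one (lyndonHom X)

theorem lyndonMap_X (l : LyndonWord X) :
    lyndonMap X (MvPolynomial.X l) = Finsupp.single l.1 1 :=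
  MvPolynomial.aeval_X (S₁ := ShuffleAlgebra X) _ l

theorem lyndonMap_mul (p q : MvPolynomial (LyndonWord X) ℝ) :
    lyndonMap X (p * q) = shuffle (lyndonMap X p) (lyndonMap X q) :=
  map_mul (lyndonHom X) p q

theorem lyndonMap_prod (ls : List (LyndonWord X)) :
    lyndonMap X (ls.map MvPolynomial.X).prod = shuffleList (ls.map Subtype.val) := by
  induction ls with
  | nil => exact lyndonMap_one
  | cons l ls ih =>
    rw [List.map_cons, List.prod_cons, lyndonMap_mul, ih, lyndonMap_X, List.map_cons, shuffleList]

theorem prod_map_X_eq_monomial {σ : Type*} [DecidableEq σ] (ls : List σ) :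
    (ls.map (MvPolynomial.X (R := ℝ))).prod =
      MvPolynomial.monomial (Multiset.toFinsupp (ls : Multiset σ)) 1 := by
  induction ls with
  | nil => simp
  | cons l ls ih =>
    rw [List.map_cons, List.prod_cons, ih, MvPolynomial.X, MvPolynomial.monomial_mul, one_mul,
      ← Multiset.cons_coe, ← Multiset.singleton_add, map_add, Multiset.toFinsupp_singleton]

/-- The factors of a Lyndon monomial, in increasing order. -/
def sortedFactors (m : LyndonWord X →₀ ℕ) : List (LyndonWord X) :=
  (Finsupp.toMultiset m).sort (· ≤ ·)

theorem toFinsupp_sortedFactors (m : LyndonWord X →₀ ℕ) :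
    Multiset.toFinsupp (sortedFactors m : Multiset (LyndonWord X)) = m := by
  rw [sortedFactors, Multiset.sort_eq, Finsupp.toMultiset_toFinsupp]

theorem sortedFactors_ne_nil {m : LyndonWord X →₀ ℕ} (hm : m ≠ 0) : sortedFactors m ≠ [] := by
  intro h
  apply hm
  rw [← toFinsupp_sortedFactors m, h]
  simp

theorem monomial_eq_prod_sortedFactors (m : LyndonWord X →₀ ℕ) :
    MvPolynomial.monomial m (1 : ℝ) = ((sortedFactors m).map MvPolynomial.X).prod := by
  rw [prod_map_X_eq_monomial, toFinsupp_sortedFactors]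

theorem pairwise_sortedFactors (m : LyndonWord X →₀ ℕ) :
    ((sortedFactors m).map Subtype.val).Pairwise (· ≤ ·) :=
  List.pairwise_map.2 (Multiset.pairwise_sort _ _)

theorem isLyndon_of_mem_map_val {ls : List (LyndonWord X)} :
    ∀ l ∈ ls.map Subtype.val, IsLyndon l := by
  intro l hl
  obtain ⟨x, -, rfl⟩ := List.mem_map.1 hl
  exact x.2

/-- The nonincreasing concatenation of the factors of a Lyndon monomial. -/
def leadingWord (m : LyndonWord X →₀ ℕ) : List X :=
  revConcat ((sortedFactors m).map Subtype.val)

theorem leadingWord_injective : Function.Injective (leadingWord (X := X)) := by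
  intro m m' h
  have := revConcat_injOn isLyndon_of_mem_map_val isLyndon_of_mem_map_val
    (pairwise_sortedFactors m) (pairwise_sortedFactors m') h
  rw [← toFinsupp_sortedFactors m, ← toFinsupp_sortedFactors m',
    List.map_injective_iff.2 Subtype.val_injective this]

theorem leadingWord_surjective : Function.Surjective (leadingWord (X := X)) := by
  intro w
  obtain ⟨ls, hls, hsort, rfl⟩ := exists_revConcat_eq w
  lift ls to List (LyndonWord X) using hls
  refine ⟨Multiset.toFinsupp (ls : Multiset (LyndonWord X)), ?_⟩
  have hsort' : ls.Pairwise (· ≤ ·) := (List.pairwise_map (f := Subtype.val)).1 hsort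
  rw [leadingWord, sortedFactors, Multiset.toFinsupp_toMultiset, Multiset.coe_sort,
    List.mergeSort_of_pairwise (by simpa using hsort')]

theorem leadingWord_zero : leadingWord (0 : LyndonWord X →₀ ℕ) = [] := by
  simp [leadingWord, sortedFactors]

theorem length_revConcat {Y : Type*} (ls : List (List Y)) :
    (revConcat ls).length = (ls.map List.length).sum := by
  induction ls with
  | nil => rfl
  | cons l ls ih =>
    rw [revConcat_cons, List.length_append, ih, List.map_cons, List.sum_cons, add_comm]

theorem length_leadingWord (m : LyndonWord X →₀ ℕ) :
    (leadingWord m).length = Finsupp.weight (fun l : LyndonWord X => l.1.length) m := by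
  rw [leadingWord, length_revConcat, List.map_map]
  conv_rhs => rw [← toFinsupp_sortedFactors m]
  induction sortedFactors m with
  | nil => simp
  | cons l ls ih =>
    rw [List.map_cons, List.sum_cons, ih, ← Multiset.cons_coe, ← Multiset.singleton_add, map_add,
      map_add, Multiset.toFinsupp_singleton, Finsupp.weight_single, one_smul]
    rfl

theorem lyndonMap_monomial (m : LyndonWord X →₀ ℕ) :
    lyndonMap X (MvPolynomial.monomial m 1) = shuffleList ((sortedFactors m).map Subtype.val) := by
  rw [monomial_eq_prod_sortedFactors, lyndonMap_prod]

theorem lyndonMap_monomial_leadingWord_pos (m : LyndonWord X →₀ ℕ) :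
    0 < lyndonMap X (MvPolynomial.monomial m 1) (leadingWord m) := by
  rw [lyndonMap_monomial]
  exact shuffleList_revConcat_pos _

theorem le_leadingWord {m : LyndonWord X →₀ ℕ} {w : List X}
    (h : lyndonMap X (MvPolynomial.monomial m 1) w ≠ 0) : w ≤ leadingWord m := by
  rw [lyndonMap_monomial] at h
  exact le_revConcat_of_shuffleList_ne_zero isLyndon_of_mem_map_val (pairwise_sortedFactors m) h

theorem length_eq_of_lyndonMap_monomial_ne_zero {m : LyndonWord X →₀ ℕ} {w : List X}
    (h : lyndonMap X (MvPolynomial.monomial m 1) w ≠ 0) :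
    w.length = (leadingWord m).length := by
  rw [lyndonMap_monomial] at h
  exact length_of_shuffleList_ne_zero h

theorem lyndonMap_apply (p : MvPolynomial (LyndonWord X) ℝ) (w : List X) :
    lyndonMap X p w = ∑ m ∈ p.support,
      p.coeff m * lyndonMap X (MvPolynomial.monomial m 1) w := by
  conv_lhs => rw [p.as_sum, map_sum, Finsupp.finsetSum_apply]
  refine Finset.sum_congr rfl fun m _ => ?_
  rw [← mul_one (p.coeff m), ← smul_eq_mul, ← MvPolynomial.smul_monomial, map_smul]
  simp

/-- Among the monomials of p, the one with the largest leading word is alone in contributing to that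
word. -/
theorem lyndonMap_injective : Function.Injective (lyndonMap X) := by
  rw [← LinearMap.ker_eq_bot, LinearMap.ker_eq_bot']
  intro p hp
  by_contra hne
  obtain ⟨m, hm, hmax⟩ := p.support.exists_max_image leadingWord
    (MvPolynomial.support_nonempty.2 hne)
  have h := lyndonMap_apply p (leadingWord m)
  rw [hp, Finset.sum_eq_single m] at h
  · exact mul_ne_zero (MvPolynomial.mem_support_iff.1 hm)
      (lyndonMap_monomial_leadingWord_pos m).ne' h.symm
  · intro m' hm' hne'
    by_contra h0
    exact hne' (leadingWord_injective
      (le_antisymm (hmax m' hm') (le_leadingWord (right_ne_zero_of_mul h0))))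
  · exact fun h => absurd hm h

theorem lyndonMap_mem_supported {p : MvPolynomial (LyndonWord X) ℝ} {k : ℕ}
    (hp : p ∈ MvPolynomial.weightedHomogeneousSubmodule ℝ
      (fun l : LyndonWord X => l.1.length) k) :
    lyndonMap X p ∈ Finsupp.supported ℝ ℝ {w : List X | w.length = k} := by
  rw [Finsupp.mem_supported']
  intro w hw
  rw [lyndonMap_apply]
  refine Finset.sum_eq_zero fun m hm => ?_
  by_contra h0
  apply hw
  rw [Set.mem_ofPred_eq, length_eq_of_lyndonMap_monomial_ne_zero (right_ne_zero_of_mul h0),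
    length_leadingWord]
  exact (MvPolynomial.mem_weightedHomogeneousSubmodule ℝ _ _ _).1 hp
    (MvPolynomial.mem_support_iff.1 hm)

/-- Triangular elimination: w is the leading word of some monomial, whose image has only smaller
words of the same length besides w. -/
theorem single_mem_map_lyndonMap [Finite X] (w : List X) :
    (Finsupp.single w 1 : NCPoly X) ∈ (MvPolynomial.weightedHomogeneousSubmodule ℝ
      (fun l : LyndonWord X => l.1.length) w.length).map (lyndonMap X) := by
  generalize hk : w.length = k
  set M := (MvPolynomial.weightedHomogeneousSubmodule ℝ
      (fun l : LyndonWord X => l.1.length) k).map (lyndonMap X)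
  -- Lexicographic order need not be well founded on all words (b > ab > aab > ⋯), but it is on the
  -- finite set of words of one length.
  have hfin : {w : List X | w.length = k}.Finite := List.finite_length_eq X k
  refine hfin.wellFoundedOn (r := (· < ·)).induction hk
    (P := fun w => (Finsupp.single w 1 : NCPoly X) ∈ M) fun w hw ih => ?_
  obtain ⟨m, rfl⟩ := leadingWord_surjective w
  set f := lyndonMap X (MvPolynomial.monomial m 1) with hf
  have hfM : f ∈ M := by
    refine Submodule.mem_map_of_mem ?_
    rw [MvPolynomial.mem_weightedHomogeneousSubmodule]
    exact MvPolynomial.isWeightedHomogeneous_monomial _ _ _ ((length_leadingWord m).symm.trans hw)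
  have hc : f (leadingWord m) ≠ 0 := (lyndonMap_monomial_leadingWord_pos m).ne'
  have hdecomp : Finsupp.single (leadingWord m) (f (leadingWord m)) =
      f - (f.erase (leadingWord m)) :=
    eq_sub_of_add_eq (Finsupp.single_add_erase _ _)
  have herase : f.erase (leadingWord m) ∈ M := by
    rw [← Finsupp.sum_single (f.erase (leadingWord m))]
    refine Submodule.sum_mem _ fun v hv => ?_
    rw [← Finsupp.smul_single_one]
    rw [Finsupp.support_erase, Finset.mem_erase, Finsupp.mem_support_iff] at hv
    exact M.smul_mem _ (ih v ((length_eq_of_lyndonMap_monomial_ne_zero hv.2).trans hw)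
      (lt_of_le_of_ne (le_leadingWord hv.2) hv.1))
  have hmem : Finsupp.single (leadingWord m) (f (leadingWord m)) ∈ M :=
    hdecomp ▸ M.sub_mem hfM herase
  rw [← Finsupp.smul_single_one] at hmem
  exact (Submodule.smul_mem_iff M hc).1 hmem

theorem lyndonMap_surjective [Finite X] : Function.Surjective (lyndonMap X) := by
  rw [← LinearMap.range_eq_top, eq_top_iff]
  intro p _
  rw [← Finsupp.sum_single p]
  refine Submodule.sum_mem _ fun w _ => ?_
  rw [← Finsupp.smul_single_one]
  exact Submodule.smul_mem _ _ (LinearMap.map_le_range (single_mem_map_lyndonMap w))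

/-- The degree-k words already have preimages of degree k, and injectivity makes these the only
ones. -/
theorem lyndonMap_mem_supported_iff [Finite X] {p : MvPolynomial (LyndonWord X) ℝ} {k : ℕ} :
    lyndonMap X p ∈ Finsupp.supported ℝ ℝ {w : List X | w.length = k} ↔
      p ∈ MvPolynomial.weightedHomogeneousSubmodule ℝ
        (fun l : LyndonWord X => l.1.length) k := by
  refine ⟨fun h => ?_, lyndonMap_mem_supported⟩
  have hle : Finsupp.supported ℝ ℝ {w : List X | w.length = k} ≤
      (MvPolynomial.weightedHomogeneousSubmodule ℝ
        (fun l : LyndonWord X => l.1.length) k).map (lyndonMap X) := by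
    rw [Finsupp.supported_eq_span_single, Submodule.span_le]
    rintro _ ⟨w, rfl, rfl⟩
    exact single_mem_map_lyndonMap w
  obtain ⟨q, hq, hqp⟩ := hle h
  exact lyndonMap_injective hqp ▸ hq

theorem lyndonMap_apply_nil (p : MvPolynomial (LyndonWord X) ℝ) :
    lyndonMap X p [] = p.coeff 0 := by
  rw [lyndonMap_apply, Finset.sum_eq_single 0]
  · rw [← MvPolynomial.one_def, lyndonMap_one, Finsupp.single_eq_same, mul_one]
  · intro m _ hm
    by_contra h0
    have := length_eq_of_lyndonMap_monomial_ne_zero (right_ne_zero_of_mul h0)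
    rw [List.length_nil, eq_comm, List.length_eq_zero_iff, ← leadingWord_zero (X := X)] at this
    exact hm (leadingWord_injective this)
  · intro h
    rw [MvPolynomial.notMem_support_iff.1 h, zero_mul]

theorem lyndonMap_mem_properPoly_iff {p : MvPolynomial (LyndonWord X) ℝ} :
    lyndonMap X p ∈ properPoly X ↔ p ∈ lyndonPoly X := by
  change lyndonMap X p [] = 0 ↔ p.coeff 0 = 0
  rw [lyndonMap_apply_nil]

end Radford

/-! ### Restriction to proper polynomials, and uniqueness of the two maps. -/

section Proper

variable {X : Type*} [LinearOrder X]

theorem map_lyndonPoly [Finite X] : (lyndonPoly X).map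
    (LinearEquiv.ofBijective (lyndonMap X) ⟨lyndonMap_injective, lyndonMap_surjective⟩ :
      MvPolynomial (LyndonWord X) ℝ →ₗ[ℝ] NCPoly X) = properPoly X := by
  refine le_antisymm ?_ fun q hq => ?_
  · rintro _ ⟨p, hp, rfl⟩
    exact lyndonMap_mem_properPoly_iff.2 hp
  · obtain ⟨p, rfl⟩ := lyndonMap_surjective q
    exact ⟨p, lyndonMap_mem_properPoly_iff.1 hq, rfl⟩

/-- The isomorphism sending a Lyndon monomial to the shuffle product of its factors. -/
def lyndonEquiv (X : Type*) [LinearOrder X] [Finite X] : lyndonPoly X ≃ₗ[ℝ] properPoly X :=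
  (LinearEquiv.ofBijective (lyndonMap X) ⟨lyndonMap_injective, lyndonMap_surjective⟩).ofSubmodules
    (lyndonPoly X) (properPoly X) map_lyndonPoly

theorem coe_lyndonEquiv [Finite X] (p : lyndonPoly X) :
    (lyndonEquiv X p : NCPoly X) = lyndonMap X p := rfl

theorem lyndonEquiv_mem_wordGrade_iff [Finite X] {p : lyndonPoly X} {k : ℕ+} :
    lyndonEquiv X p ∈ wordGrade X k ↔ p ∈ lyndonGrade X k :=
  lyndonMap_mem_supported_iff

/-- A linear map on `lyndonPoly X` is determined by its values on Lyndon monomials. -/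
theorem lyndonPoly_hom_ext {M : Type*} [AddCommMonoid M] [Module ℝ M]
    {f g : lyndonPoly X →ₗ[ℝ] M}
    (h : ∀ (ls : List (LyndonWord X)) (hls : ls ≠ []),
      f (lyndonMonomial ls hls) = g (lyndonMonomial ls hls)) : f = g := by
  -- Dropping the constant term retracts onto `lyndonPoly X`, so f and g can be compared on the
  -- monomial basis of the full polynomial ring.
  let π : MvPolynomial (LyndonWord X) ℝ →ₗ[ℝ] lyndonPoly X :=
    LinearMap.codRestrict (lyndonPoly X)
      (LinearMap.id - (MvPolynomial.monomial 0).comp (MvPolynomial.lcoeff ℝ 0)) fun p => by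
        change MvPolynomial.coeff 0 (p - MvPolynomial.monomial 0 (MvPolynomial.coeff 0 p)) = 0
        simp
  have hπ : ∀ p : lyndonPoly X, π p = p := fun p => by
    have hp : MvPolynomial.coeff 0 (p : MvPolynomial (LyndonWord X) ℝ) = 0 := p.2
    ext1
    change (p : MvPolynomial (LyndonWord X) ℝ) - MvPolynomial.monomial 0
      (MvPolynomial.coeff 0 (p : MvPolynomial (LyndonWord X) ℝ)) =
        (p : MvPolynomial (LyndonWord X) ℝ)
    rw [hp, map_zero, sub_zero]
  have hfg : f ∘ₗ π = g ∘ₗ π := by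
    refine MvPolynomial.linearMap_ext fun m => LinearMap.ext_ring ?_
    change f (π (MvPolynomial.monomial m 1)) = g (π (MvPolynomial.monomial m 1))
    rcases eq_or_ne m 0 with rfl | hm
    · have h0 : π (MvPolynomial.monomial 0 1) = 0 := by
        ext1
        change MvPolynomial.monomial (0 : LyndonWord X →₀ ℕ) (1 : ℝ) - MvPolynomial.monomial 0
          (MvPolynomial.coeff 0 (MvPolynomial.monomial 0 (1 : ℝ))) = 0
        simp
      rw [h0, map_zero, map_zero]
    · have hm' : π (MvPolynomial.monomial m 1) =
          lyndonMonomial (sortedFactors m) (sortedFactors_ne_nil hm) := by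
        ext1
        change MvPolynomial.monomial m (1 : ℝ) - MvPolynomial.monomial 0
          (MvPolynomial.coeff 0 (MvPolynomial.monomial m (1 : ℝ))) =
            ((sortedFactors m).map MvPolynomial.X).prod
        rw [MvPolynomial.coeff_monomial, if_neg hm, map_zero, sub_zero,
          monomial_eq_prod_sortedFactors]
      rw [hm', h]
  refine LinearMap.ext fun p => ?_
  have := LinearMap.congr_fun hfg (p : MvPolynomial (LyndonWord X) ℝ)
  rwa [LinearMap.comp_apply, LinearMap.comp_apply, hπ] at this

theorem isShuffleMap_lyndonEquiv [Finite X] :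
    IsShuffleMap (lyndonEquiv X : lyndonPoly X →ₗ[ℝ] properPoly X) :=
  fun ls _ => lyndonMap_prod ls

theorem IsShuffleMap.eq_lyndonEquiv [Finite X] {Ψ : lyndonPoly X →ₗ[ℝ] properPoly X}
    (hΨ : IsShuffleMap Ψ) : Ψ = lyndonEquiv X :=
  lyndonPoly_hom_ext fun ls hls =>
    Subtype.ext ((hΨ ls hls).trans (isShuffleMap_lyndonEquiv ls hls).symm)

theorem isLyndonMap_lyndonEquiv_symm [Finite X] :
    IsLyndonMap ((lyndonEquiv X).symm : properPoly X →ₗ[ℝ] lyndonPoly X) where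
  map_shuffle p q := by
    obtain ⟨p, rfl⟩ := (lyndonEquiv X).surjective p
    obtain ⟨q, rfl⟩ := (lyndonEquiv X).surjective q
    apply lyndonMap_injective
    rw [lyndonMap_mul]
    simp only [LinearEquiv.coe_coe, LinearEquiv.symm_apply_apply]
    rw [← coe_lyndonEquiv, LinearEquiv.apply_symm_apply]
    rfl
  map_lyndon l := by
    apply lyndonMap_injective
    rw [LinearEquiv.coe_coe, ← coe_lyndonEquiv, LinearEquiv.apply_symm_apply, lyndonMap_X]
    rfl

/-- Multiplicativity and the values on Lyndon words determine ℒ on every shuffle of Lyndon words. -/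
theorem IsLyndonMap.comp_lyndonEquiv [Finite X] {ℒ : properPoly X →ₗ[ℝ] lyndonPoly X}
    (hℒ : IsLyndonMap ℒ) : ℒ ∘ₗ (lyndonEquiv X : lyndonPoly X →ₗ[ℝ] properPoly X) =
      LinearMap.id := by
  refine lyndonPoly_hom_ext fun ls hls => ?_
  ext1
  change (ℒ (lyndonEquiv X (lyndonMonomial ls hls)) : MvPolynomial (LyndonWord X) ℝ) =
    (ls.map MvPolynomial.X).prod
  induction ls with
  | nil => exact absurd rfl hls
  | cons l ls ih =>
    -- The proper polynomials contain no unit, so the induction starts at a single factor.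
    rcases eq_or_ne ls [] with rfl | hne
    · have h : lyndonEquiv X (lyndonMonomial [l] hls) = ofWord l.1 l.2.1 := by
        ext1
        rw [coe_lyndonEquiv]
        refine (lyndonMap_prod [l]).trans ?_
        simp [shuffleList, shuffle_nil, ofWord]
      rw [h, hℒ.map_lyndon]
      simp
    · have h : lyndonEquiv X (lyndonMonomial (l :: ls) hls) =
          properShuffle (ofWord l.1 l.2.1) (lyndonEquiv X (lyndonMonomial ls hne)) := by
        ext1
        change lyndonMap X ((l :: ls).map MvPolynomial.X).prod =
          shuffle (Finsupp.single l.1 1) (lyndonMap X (ls.map MvPolynomial.X).prod)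
        rw [lyndonMap_prod, lyndonMap_prod, List.map_cons, shuffleList]
      rw [h, hℒ.map_shuffle, hℒ.map_lyndon, ih hne, List.map_cons, List.prod_cons]

theorem IsLyndonMap.eq_lyndonEquiv_symm [Finite X] {ℒ : properPoly X →ₗ[ℝ] lyndonPoly X}
    (hℒ : IsLyndonMap ℒ) : ℒ = (lyndonEquiv X).symm := by
  refine LinearMap.ext fun p => ?_
  obtain ⟨q, rfl⟩ := (lyndonEquiv X).surjective p
  rw [LinearEquiv.coe_coe, LinearEquiv.symm_apply_apply]
  exact LinearMap.congr_fun hℒ.comp_lyndonEquiv q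

theorem map_wordGrade_lyndonEquiv_symm [Finite X] (k : ℕ+) :
    (wordGrade X k).map ((lyndonEquiv X).symm : properPoly X →ₗ[ℝ] lyndonPoly X) =
      lyndonGrade X k := by
  ext p
  rw [← lyndonEquiv_mem_wordGrade_iff]
  constructor
  · rintro ⟨q, hq, rfl⟩
    simpa using hq
  · exact fun h => ⟨_, h, (lyndonEquiv X).symm_apply_apply p⟩

end Proper

/-! ### Direct sum decompositions by word length. -/

section Gradings

theorem iSupIndep_wordGrade (X : Type*) : iSupIndep (wordGrade X) := by
  intro k
  rw [Submodule.disjoint_def]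
  intro p hp hp'
  have hle : (⨆ (j : ℕ+) (_ : j ≠ k), wordGrade X j) ≤
      (Finsupp.supported ℝ ℝ {w : List X | w.length ≠ (k : ℕ)}).submoduleOf (properPoly X) :=
    iSup₂_le fun j hj => Submodule.comap_mono (Finsupp.supported_mono fun w hw => by
      rw [Set.mem_ofPred_eq] at hw ⊢
      rw [hw]
      exact fun h => hj (PNat.coe_injective h))
  have h1 : (p : NCPoly X) ∈ Finsupp.supported ℝ ℝ {w : List X | w.length = (k : ℕ)} := hp
  have h2 : (p : NCPoly X) ∈ Finsupp.supported ℝ ℝ {w : List X | w.length ≠ (k : ℕ)} := hle hp'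
  rw [Finsupp.mem_supported'] at h1 h2
  ext w
  by_cases hw : w.length = (k : ℕ)
  · exact h2 w (by simpa using hw)
  · exact h1 w hw

theorem iSup_wordGrade (X : Type*) : iSup (wordGrade X) = ⊤ := by
  rw [eq_top_iff]
  intro p _
  have hp : p = ∑ w ∈ (p : NCPoly X).support.attach, (p : NCPoly X) w.1 •
      ofWord w.1 (by
        intro h
        exact Finsupp.mem_support_iff.1 w.2 (h ▸ p.2)) := by
    ext1
    rw [AddSubmonoidClass.coe_finsetSum]
    simp only [Submodule.coe_smul, ofWord, Finsupp.smul_single_one]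
    rw [Finset.sum_attach _ fun w => Finsupp.single w ((p : NCPoly X) w)]
    exact (Finsupp.sum_single (p : NCPoly X)).symm
  rw [hp]
  refine Submodule.sum_mem _ fun w hw => Submodule.smul_mem _ _ ?_
  have hne : w.1 ≠ [] := fun h => Finsupp.mem_support_iff.1 w.2 (h ▸ p.2)
  refine Submodule.mem_iSup_of_mem ⟨w.1.length, List.length_pos_iff.2 hne⟩ ?_
  exact Finsupp.single_mem_supported ℝ 1 rfl

theorem isInternal_wordGrade (X : Type*) : DirectSum.IsInternal (wordGrade X) :=
  DirectSum.isInternal_submodule_of_iSupIndep_of_iSup_eq_top (R := ℝ) (M := properPoly X)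
    (iSupIndep_wordGrade X) (iSup_wordGrade X)

theorem isInternal_lyndonGrade (X : Type*) [LinearOrder X] [Finite X] :
    DirectSum.IsInternal (lyndonGrade X) := by
  rw [DirectSum.isInternal_submodule_iff_iSupIndep_and_iSup_eq_top]
  -- The decomposition is transported from the word side along the graded isomorphism.
  have h : lyndonGrade X =
      fun k => (wordGrade X k).map ((lyndonEquiv X).symm : properPoly X →ₗ[ℝ] lyndonPoly X) :=
    funext fun k => (map_wordGrade_lyndonEquiv_symm k).symm
  rw [h]
  constructor
  · exact (iSupIndep_map_orderIso_iff (Submodule.orderIsoMapComap (lyndonEquiv X).symm)).2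
      (iSupIndep_wordGrade X)
  · rw [← Submodule.map_iSup, iSup_wordGrade, Submodule.map_top, LinearEquiv.range]

end Gradings

end

end LyndonShuffle

theorem mainTheorem3 {X : Type*} [Finite X] [LinearOrder X] :
    -- the gradings of the two spaces by word length
    DirectSum.IsInternal (LyndonShuffle.wordGrade X) ∧
    DirectSum.IsInternal (LyndonShuffle.lyndonGrade X) ∧
    -- the maps `ℒ` and `Ψ` are well defined
    (∃! ℒ : LyndonShuffle.properPoly X →ₗ[ℝ] LyndonShuffle.lyndonPoly X,
      LyndonShuffle.IsLyndonMap ℒ) ∧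
    (∃! Ψ : LyndonShuffle.lyndonPoly X →ₗ[ℝ] LyndonShuffle.properPoly X,
      LyndonShuffle.IsShuffleMap Ψ) ∧
    -- `ℒ` is an isomorphism of graded vector spaces, with inverse `Ψ`
    ∀ (ℒ : LyndonShuffle.properPoly X →ₗ[ℝ] LyndonShuffle.lyndonPoly X)
      (Ψ : LyndonShuffle.lyndonPoly X →ₗ[ℝ] LyndonShuffle.properPoly X),
      LyndonShuffle.IsLyndonMap ℒ → LyndonShuffle.IsShuffleMap Ψ →
        Function.Bijective ℒ ∧
        Ψ ∘ₗ ℒ = LinearMap.id ∧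
        ℒ ∘ₗ Ψ = LinearMap.id ∧
        ∀ k : ℕ+, (LyndonShuffle.wordGrade X k).map ℒ = LyndonShuffle.lyndonGrade X k := by
  refine ⟨LyndonShuffle.isInternal_wordGrade X, LyndonShuffle.isInternal_lyndonGrade X,
    ⟨_, LyndonShuffle.isLyndonMap_lyndonEquiv_symm, fun _ h => h.eq_lyndonEquiv_symm⟩,
    ⟨_, LyndonShuffle.isShuffleMap_lyndonEquiv, fun _ h => h.eq_lyndonEquiv⟩, ?_⟩
  intro ℒ Ψ hℒ hΨ
  obtain rfl := hℒ.eq_lyndonEquiv_symm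
  obtain rfl := hΨ.eq_lyndonEquiv
  refine ⟨(LyndonShuffle.lyndonEquiv X).symm.bijective, ?_, ?_,
    LyndonShuffle.map_wordGrade_lyndonEquiv_symm⟩
  · ext1 p
    exact (LyndonShuffle.lyndonEquiv X).apply_symm_apply p
  · ext1 p
    exact (LyndonShuffle.lyndonEquiv X).symm_apply_apply p
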